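/- Let $k\ge 2$ be an integer. For $f_1,\dots,f_k:\{0,1\}\to\mathbb{R}$ let $(f_1*\cdots*f_k)(n)=\sum_{x_1+\cdots+x_k=n}f_1(x_1)\cdots f_k(x_k)$, $n\in\mathbb{Z}$, the sum being over $x\in\{0,1\}^k$; let $\|g\|_\infty=\sup_{n\in\mathbb{Z}}|g(n)|$ and $\|f\|_1=|f(0)|+|f(1)|$. Let $C_{k,1}$ be the largest constant $C$ such that $$\|f_1*\cdots*f_k\|_\infty\ \ge\ C\,\|f_1\|_1\cdots\|f_k\|_1\qquad\text{for all } f_1,\dots,f_k:\{0,1\}\to[0,\infty),$$ and let $\bar C_{k,1}$ be the largest constant $C$ such that $$\|\underbrace{f*\cdots*f}_{k}\|_\infty\ \ge\ C\,\|f\|_1^k\qquad\text{for all } f:\{0,1\}\to[0,\infty).$$ Then both largest constants exist, and $$C_{k,1}=\bar C_{k,1}=\binom{k}{\lfloor k/2\rfloor}\left(\frac{\lfloor\frac{k+1}{2}\rfloor\lceil\frac{k+1}{2}\rceil}{(k+1)^2}\right)^{k/2}=\begin{cases}\dfrac{1}{2^k}\dbinom{k}{\lfloor k/2\rfloor}, &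 k\text{ odd},\\[2ex] \dfrac{1}{2^k}\dbinom{k}{\lfloor k/2\rfloor}\left(1-\dfrac{1}{(k+1)^2}\right)^{k/2}, & k\text{ even}.\end{cases}$$ Moreover, the inequality $\|f*\cdots*f\|_\infty\ge\bar C_{k,1}\|f\|_1^k$ holds for all $f:\{0,1\}\to\mathbb{R}$. Equivalently, in terms of probability: for $p\in[0,1]^k$ let $M(p)$ be the largest of the probabilities, over $0\le j\le k$, of exactly $j$ successes in $k$ independent trials with success probabilities $p_1,\dots,p_k$. Then $\min_{p\in[0,1]^k}M(p)=C_{k,1}$, and the minimum is attained at some $p$ with $p_1=\cdots=p_k$. -/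

import Mathlib

noncomputable section

namespace ConvCube

/-- The `k`-fold convolution `f₁ * ⋯ * f_k` on `ℤ` of functions `fᵢ : {0, …, m} → ℝ`
(extended by zero to `ℤ`):
`(f₁ * ⋯ * f_k)(n) = ∑_{x₁ + ⋯ + x_k = n} f₁(x₁) ⋯ f_k(x_k)`. -/
def conv {k m : ℕ} (f : Fin k → Fin (m + 1) → ℝ) (n : ℤ) : ℝ :=
  ∑ x : Fin k → Fin (m + 1) with ∑ i, ((x i : ℕ) : ℤ) = n, ∏ i, f i (x i)

/-- The supremum norm of a function on `ℤ` (used for functions of finite support only). -/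
def supNorm (g : ℤ → ℝ) : ℝ := ⨆ n : ℤ, |g n|

/-- The `ℓ¹` norm of a function on `{0, …, m}`. -/
def l1Norm {m : ℕ} (f : Fin (m + 1) → ℝ) : ℝ := ∑ j, |f j|

/-- The constants `C` such that `‖f₁ * ⋯ * f_k‖_∞ ≥ C ‖f₁‖₁ ⋯ ‖f_k‖₁` for all nonnegative
`f₁, …, f_k` on `{0, …, m}`. -/
def constants (k m : ℕ) : Set ℝ :=
  {C | ∀ f : Fin k → Fin (m + 1) → ℝ, (∀ i j, 0 ≤ f i j) →
    C * ∏ i, l1Norm (f i) ≤ supNorm (conv f)}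

/-- The constants `C` such that `‖f * ⋯ * f‖_∞ ≥ C ‖f‖₁ ^ k` (`k` factors) for all nonnegative
`f` on `{0, …, m}`. -/
def diagConstants (k m : ℕ) : Set ℝ :=
  {C | ∀ f : Fin (m + 1) → ℝ, (∀ j, 0 ≤ f j) →
    C * l1Norm f ^ k ≤ supNorm (conv fun _ : Fin k => f)}

/-- The best constant `C_{k,m}`. -/
def bestConst (k m : ℕ) : ℝ := sSup (constants k m)

/-- The best diagonal constant `C̄_{k,m}`. -/
def diagBestConst (k m : ℕ) : ℝ := sSup (diagConstants k m)

/-- The Poisson binomial probability of exactly `j` successes in `k` independent trials with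
success probabilities `p₁, …, p_k`. -/
def pbProb {k : ℕ} (p : Fin k → ℝ) (j : ℕ) : ℝ :=
  ∑ S ∈ Finset.powersetCard j (Finset.univ : Finset (Fin k)),
    (∏ i ∈ S, p i) * ∏ i ∈ Sᶜ, (1 - p i)

/-- The largest of the Poisson binomial probabilities of `0, 1, …, k` successes. -/
def pbMax {k : ℕ} (p : Fin k → ℝ) : ℝ :=
  (Finset.range (k + 1)).sup' Finset.nonempty_range_add_one (pbProb p)

end ConvCube

end

/-! After rescaling, each `f i` is a Bernoulli distribution and the convolution is a Poisson
binomial distribution, so the task is to minimise its largest value over `p ∈ [0,1]^k`. A minimiser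
exists by compactness.

Suppose that all its coordinates lie in (0,1) and two of them differ. The distribution depends on
these two only through their sum and product, which can be varied independently because the two
differ. Strict log-concavity confines the maximum to at most two adjacent points, and the two free
rates can be chosen to lower both values (`StrictLogConcave.exists_direction`, `exists_pmfMax_lt`).
Hence such a minimiser is constant. A coordinate equal to 0 or 1 only shifts the distribution, so
induction on the number of trials applies (`exists_const_pmfMax_le`).

For equal probabilities `q` in [j/(k+1), (j+1)/(k+1)], the probability of `j` successes is
quasiconcave in `q`, hence at least its smaller endpoint value. Endpoint values are k!/(k+1)^k ·
g(a) g(b) with a + b = k + 1 and g(n) = n^n/n!. Since g is log-convex, the balanced split is least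
(`exists_binomialPeak_le`), and at the corresponding `q` this value is the maximum of the
distribution (`binomial_le_binomialPeak`). -/

open Filter Topology

namespace ConvCube

/-! ### Strictly log-concave sequences -/

/-- Nonnegative sequences on `ℤ` satisfying `a (i - 1) * a (j + 1) ≤ a i * a j` for `i ≤ j`, with
strict inequality where the right-hand side is positive. -/
structure StrictLogConcave (a : ℤ → ℝ) : Prop where
  nonneg : ∀ n, 0 ≤ a n
  le : ∀ i j, i ≤ j → a (i - 1) * a (j + 1) ≤ a i * a j
  lt : ∀ i j, i ≤ j → 0 < a i → 0 < a j → a (i - 1) * a (j + 1) < a i * a j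

/-- The log-concavity defect of the new sequence is a combination of three nonnegative defects of
`a`, with weights (1-p)^2, p^2 and p(1-p). -/
theorem StrictLogConcave.bernoulli_step {a : ℤ → ℝ} (ha : StrictLogConcave a) {p : ℝ}
    (h0 : 0 < p) (h1 : p < 1) :
    StrictLogConcave fun n => (1 - p) * a n + p * a (n - 1) := by
  have hq : 0 < 1 - p := by linarith
  have key : ∀ i j, i ≤ j → 0 ≤ a i * a (j - 1) - a (i - 2) * a (j + 1) := by
    intro i j hij
    have h2 := ha.le (i - 1) j (by omega)
    have e : i - 1 - 1 = i - 2 := by ring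
    rw [e] at h2
    rcases eq_or_lt_of_le hij with rfl | h
    · nlinarith
    · have h3 := ha.le i (j - 1) (by omega)
      rw [sub_add_cancel] at h3
      linarith
  have expand : ∀ i j : ℤ,
      ((1 - p) * a i + p * a (i - 1)) * ((1 - p) * a j + p * a (j - 1)) -
        ((1 - p) * a (i - 1) + p * a (i - 1 - 1)) *
          ((1 - p) * a (j + 1) + p * a (j + 1 - 1)) =
      (1 - p) ^ 2 * (a i * a j - a (i - 1) * a (j + 1)) +
        p ^ 2 * (a (i - 1) * a (j - 1) - a (i - 1 - 1) * a (j - 1 + 1)) +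
        p * (1 - p) * (a i * a (j - 1) - a (i - 2) * a (j + 1)) := by
    intro i j
    have e : i - 1 - 1 = i - 2 := by ring
    rw [e, sub_add_cancel, add_sub_cancel_right]
    ring
  have hpq : 0 < p * (1 - p) := mul_pos h0 hq
  refine ⟨fun n => by have := ha.nonneg n; have := ha.nonneg (n - 1); positivity, ?_, ?_⟩
  · intro i j hij
    rw [← sub_nonneg, expand]
    have t1 := sub_nonneg.2 (ha.le i j hij)
    have t2 := sub_nonneg.2 (ha.le (i - 1) (j - 1) (by omega))
    have t3 := key i j hij
    positivity
  · intro i j hij hi hj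
    rw [← sub_pos, expand]
    have t1 := sub_nonneg.2 (ha.le i j hij)
    have t2 := sub_nonneg.2 (ha.le (i - 1) (j - 1) (by omega))
    have t3 := key i j hij
    have n1 := ha.nonneg i
    have n2 := ha.nonneg j
    have n3 := ha.nonneg (i - 1)
    have n4 := ha.nonneg (j - 1)
    -- Each of the first two cases makes one of the squared-weight defects positive. Otherwise the
    -- supports either contradict log-concavity or make the mixed defect positive.
    by_cases c1 : 0 < a i ∧ 0 < a j
    · have := sub_pos.2 (ha.lt i j hij c1.1 c1.2)
      positivity
    by_cases c2 : 0 < a (i - 1) ∧ 0 < a (j - 1)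
    · have := sub_pos.2 (ha.lt (i - 1) (j - 1) (by omega) c2.1 c2.2)
      positivity
    rcases eq_or_lt_of_le n1 with z1 | p1
    · have p3 : 0 < a (i - 1) := by
        by_contra h
        have : a (i - 1) = 0 := le_antisymm (not_lt.1 h) n3
        simp only [← z1, this] at hi
        simp at hi
      have z4 : a (j - 1) = 0 := le_antisymm (not_lt.1 fun h => c2 ⟨p3, h⟩) n4
      have p2 : 0 < a j := by
        by_contra h
        have : a j = 0 := le_antisymm (not_lt.1 h) n2
        simp only [z4, this] at hj
        simp at hj
      rcases eq_or_lt_of_le hij with rfl | h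
      · linarith
      · have := ha.le i (j - 1) (by omega)
        rw [sub_add_cancel, z4] at this
        nlinarith [mul_pos p3 p2]
    · have z2 : a j = 0 := le_antisymm (not_lt.1 fun h => c1 ⟨p1, h⟩) n2
      have p4 : 0 < a (j - 1) := by
        by_contra h
        have : a (j - 1) = 0 := le_antisymm (not_lt.1 h) n4
        simp only [z2, this] at hj
        simp at hj
      rcases eq_or_lt_of_le hij with rfl | h
      · linarith
      · have s1 := ha.lt i (j - 1) (by omega) p1 p4
        have s2 := ha.le (i - 1) j (by omega)
        have e : i - 1 - 1 = i - 2 := by ring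
        rw [sub_add_cancel] at s1
        rw [e] at s2
        have : 0 < a i * a (j - 1) - a (i - 2) * a (j + 1) := by linarith
        positivity

/-- Two maximisers at distance at least 2 could be moved inwards by one step each, making the
product strictly larger than `M * M`. -/
theorem StrictLogConcave.lt_add_two_of_isMax {a : ℤ → ℝ} (ha : StrictLogConcave a) {M : ℝ}
    (hM : 0 < M) (hle : ∀ n, a n ≤ M) {i j : ℤ} (hi : a i = M) (hj : a j = M) : j < i + 2 := by
  by_contra! h
  have h1 := ha.le (i + 1) (j - 1) (by omega)
  have h2 := ha.lt (i + 1) (j - 1) (by omega)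
  rw [add_sub_cancel_right, sub_add_cancel, hi, hj] at h1 h2
  have n1 := ha.nonneg (i + 1)
  have n2 := ha.nonneg (j - 1)
  have u : a (i + 1) * a (j - 1) ≤ M * M := mul_le_mul (hle _) (hle _) n2 hM.le
  have hpos : 0 < a (i + 1) * a (j - 1) := lt_of_lt_of_le (mul_pos hM hM) h1
  have p1 : 0 < a (i + 1) := pos_of_mul_pos_left hpos n2
  have p2 : 0 < a (j - 1) := pos_of_mul_pos_right hpos n1
  linarith [h2 p1 p2]

/-- With `D n = b n - b (n - 1)`, two consecutive values of `α * D n + β * D (n - 1)` can be made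
positive at once, unless `b` vanishes around `n`. -/
theorem StrictLogConcave.exists_direction {b : ℤ → ℝ} (hb : StrictLogConcave b) (j : ℤ)
    (hj : ¬ (b j = 0 ∧ b (j - 1) = 0 ∧ b (j - 2) = 0)) :
    ∃ α β : ℝ, ∀ n, n = j ∨ n = j + 1 →
      0 < α * (b n - b (n - 1)) + β * (b (n - 1) - b (n - 2)) ∨
        (b n = 0 ∧ b (n - 1) = 0 ∧ b (n - 2) = 0) := by
  have e1 : j + 1 - 1 = j := by ring
  have e2 : j + 1 - 2 = j - 1 := by ring
  have e3 : j - 1 - 1 = j - 2 := by ring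
  have n0 := hb.nonneg j
  have n1 := hb.nonneg (j - 1)
  have n2 := hb.nonneg (j - 2)
  have n3 := hb.nonneg (j + 1)
  have l1 := hb.le j j le_rfl
  have l2 := hb.le (j - 1) (j - 1) le_rfl
  rw [e3, sub_add_cancel] at l2
  rcases lt_trichotomy (b j) (b (j - 1)) with h | h | h
  · have hd : b (j + 1) ≤ b j := by nlinarith
    -- Here `D j < 0` and `D (j + 1) ≤ 0`. Taking `β = D j` gives the square of `D j` at `j + 1`; a
    -- sufficiently negative `α` then dominates at `j`. The case `D j > 0` is the mirror image.
    refine ⟨-(|b (j - 1) - b (j - 2)| + 1), b j - b (j - 1), ?_⟩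
    have ab := le_abs_self (b (j - 1) - b (j - 2))
    have ab0 := abs_nonneg (b (j - 1) - b (j - 2))
    rintro n (rfl | rfl)
    · left; nlinarith
    · left; rw [e1, e2]; nlinarith
  · rcases eq_or_lt_of_le n0 with z | hp
    · have z1 : b (j - 1) = 0 := by rw [← h, ← z]
      have z3 : b (j + 1) = 0 := by
        by_contra hne
        have hp2 : b (j - 2) ≠ 0 := fun z2 => hj ⟨z.symm, z1, z2⟩
        have := hb.le (j - 1) j (by omega)
        rw [e3, z1, zero_mul] at this
        have : 0 < b (j - 2) * b (j + 1) :=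
          mul_pos (lt_of_le_of_ne n2 (Ne.symm hp2)) (lt_of_le_of_ne n3 (Ne.symm hne))
        linarith
      have hp2 : b (j - 2) ≠ 0 := fun z2 => hj ⟨z.symm, z1, z2⟩
      refine ⟨0, -1, ?_⟩
      rintro n (rfl | rfl)
      · left
        have := lt_of_le_of_ne n2 (Ne.symm hp2)
        linarith
      · right
        rw [e1, e2]
        exact ⟨z3, z.symm, z1⟩
    · have s1 := hb.lt j j le_rfl hp hp
      have s2 := hb.lt (j - 1) (j - 1) le_rfl (h ▸ hp) (h ▸ hp)
      rw [e3, sub_add_cancel] at s2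
      -- A flat step between positive values is the top: strictness forces a rise before it and a
      -- fall after it.
      have d1 : b (j + 1) < b j := by nlinarith
      have d2 : b (j - 2) < b (j - 1) := by nlinarith
      refine ⟨-1, 1, ?_⟩
      rintro n (rfl | rfl)
      · left; linarith
      · left; rw [e1, e2]; linarith
  · have hd : b (j - 2) ≤ b (j - 1) := by nlinarith
    refine ⟨b j - b (j - 1), |b (j + 1) - b j| + 1, ?_⟩
    have ab := neg_abs_le (b (j + 1) - b j)
    have ab0 := abs_nonneg (b (j + 1) - b j)
    rintro n (rfl | rfl)
    · left; nlinarith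
    · left; rw [e1, e2]; nlinarith

/-- Two distinct reals can be moved so that their sum and product change linearly at prescribed
rates. -/
theorem exists_perturbation {x y : ℝ} (hxy : x < y) (σ τ : ℝ) :
    ∃ X Y : ℝ → ℝ, Continuous X ∧ Continuous Y ∧ X 0 = x ∧ Y 0 = y ∧
      ∀ᶠ ε in 𝓝 (0 : ℝ), X ε + Y ε = x + y + ε * σ ∧ X ε * Y ε = x * y + ε * τ := by
  -- The moved reals are the roots of the quadratic with the prescribed sum and product; its
  -- discriminant is positive near 0 because `x ≠ y`.
  set Δ : ℝ → ℝ := fun ε => (x + y + ε * σ) ^ 2 - 4 * (x * y + ε * τ) with hΔ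
  have hc : Continuous Δ := by fun_prop
  have h0 : Δ 0 = (y - x) ^ 2 := by simp only [hΔ]; ring
  have hs : √(Δ 0) = y - x := by rw [h0, Real.sqrt_sq (by linarith)]
  refine ⟨fun ε => (x + y + ε * σ - √(Δ ε)) / 2, fun ε => (x + y + ε * σ + √(Δ ε)) / 2,
    by fun_prop, by fun_prop, ?_, ?_, ?_⟩
  · simp only [hs]; ring
  · simp only [hs]; ring
  · have hpos : 0 < Δ 0 := by rw [h0]; have : 0 < y - x := by linarith
                              positivity
    filter_upwards [hc.continuousAt.eventually_const_lt hpos] with ε hε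
    refine ⟨by ring, ?_⟩
    have := Real.sq_sqrt hε.le
    have e : (x + y + ε * σ - √(Δ ε)) / 2 * ((x + y + ε * σ + √(Δ ε)) / 2) =
        ((x + y + ε * σ) ^ 2 - √(Δ ε) ^ 2) / 4 := by ring
    rw [e, this]
    simp only [hΔ]
    ring

theorem const_mem_Icc {ι : Type*} {q : ℝ} (hq : q ∈ Set.Icc (0 : ℝ) 1) :
    (fun _ : ι => q) ∈ Set.Icc (0 : ι → ℝ) 1 :=
  ⟨fun _ => hq.1, fun _ => hq.2⟩

/-! ### Poisson binomial distributions -/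

variable {ι : Type*} [DecidableEq ι]

/-- The Poisson binomial distribution with success probabilities `p i`, `i ∈ s`, as a function
on `ℤ`. -/
def pmf (s : Finset ι) (p : ι → ℝ) (n : ℤ) : ℝ :=
  ∑ S ∈ s.powerset, if (S.card : ℤ) = n then (∏ i ∈ S, p i) * ∏ i ∈ s \ S, (1 - p i) else 0

theorem pmf_empty (p : ι → ℝ) (n : ℤ) : pmf ∅ p n = if 0 = n then 1 else 0 := by
  simp [pmf]

theorem pmf_insert {s : Finset ι} {i : ι} (hi : i ∉ s) (p : ι → ℝ) (n : ℤ) :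
    pmf (insert i s) p n = (1 - p i) * pmf s p n + p i * pmf s p (n - 1) := by
  unfold pmf
  rw [Finset.sum_powerset_insert hi, Finset.mul_sum, Finset.mul_sum]
  congr 1
  · refine Finset.sum_congr rfl fun S hS => ?_
    have hiS : i ∉ S := fun h => hi (Finset.mem_powerset.1 hS h)
    rw [Finset.insert_sdiff_of_notMem _ hiS,
      Finset.prod_insert (fun h => hi (Finset.mem_sdiff.1 h).1)]
    split_ifs <;> ring
  · refine Finset.sum_congr rfl fun S hS => ?_
    have hiS : i ∉ S := fun h => hi (Finset.mem_powerset.1 hS h)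
    have e : insert i s \ insert i S = s \ S := by
      ext x; simp only [Finset.mem_sdiff, Finset.mem_insert]
      constructor
      · rintro ⟨h1 | h1, h2⟩
        · exact absurd (Or.inl h1) h2
        · exact ⟨h1, fun h => h2 (Or.inr h)⟩
      · rintro ⟨h1, h2⟩
        exact ⟨Or.inr h1, by rintro (rfl | h); exacts [hi h1, h2 h]⟩
    rw [Finset.card_insert_of_notMem hiS, e, Finset.prod_insert hiS]
    have : ((S.card + 1 : ℕ) : ℤ) = n ↔ (S.card : ℤ) = n - 1 := by push_cast; omega
    simp only [this]
    split_ifs <;> ring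

theorem pmf_congr {s : Finset ι} {p p' : ι → ℝ} (h : ∀ i ∈ s, p i = p' i) (n : ℤ) :
    pmf s p n = pmf s p' n := by
  unfold pmf
  refine Finset.sum_congr rfl fun S hS => ?_
  rw [Finset.prod_congr rfl fun i hi => h i (Finset.mem_powerset.1 hS hi),
    Finset.prod_congr rfl fun i hi => congrArg (1 - ·) (h i (Finset.mem_sdiff.1 hi).1)]

theorem pmf_nonneg {s : Finset ι} {p : ι → ℝ} (hp : p ∈ Set.Icc (0 : ι → ℝ) 1) (n : ℤ) :
    0 ≤ pmf s p n := by
  unfold pmf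
  refine Finset.sum_nonneg fun S _ => ?_
  split_ifs
  · exact mul_nonneg (Finset.prod_nonneg fun i _ => hp.1 i)
      (Finset.prod_nonneg fun i _ => sub_nonneg.2 (hp.2 i))
  · rfl

theorem pmf_eq_zero {s : Finset ι} {p : ι → ℝ} {n : ℤ} (hn : n < 0 ∨ (s.card : ℤ) < n) :
    pmf s p n = 0 := by
  unfold pmf
  refine Finset.sum_eq_zero fun S hS => if_neg ?_
  have := Finset.card_le_card (Finset.mem_powerset.1 hS)
  omega

theorem pmf_zero (s : Finset ι) (p : ι → ℝ) : pmf s p 0 = ∏ i ∈ s, (1 - p i) := by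
  induction s using Finset.induction_on with
  | empty => simp [pmf_empty]
  | insert i s hi ih =>
    rw [pmf_insert hi, Finset.prod_insert hi, ih, pmf_eq_zero (n := 0 - 1) (by omega)]
    ring

theorem continuous_pmf (s : Finset ι) (n : ℤ) : Continuous fun p : ι → ℝ => pmf s p n := by
  unfold pmf
  refine continuous_finsetSum _ fun S _ => ?_
  split_ifs
  · fun_prop
  · exact continuous_const

theorem strictLogConcave_pmf {s : Finset ι} {p : ι → ℝ} (hp : ∀ i ∈ s, 0 < p i ∧ p i < 1) :
    StrictLogConcave (pmf s p) := by
  induction s using Finset.induction_on with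
  | empty =>
    refine ⟨fun n => by rw [pmf_empty]; split_ifs <;> norm_num, fun i j hij => ?_,
      fun i j hij => ?_⟩ <;> simp only [pmf_empty] <;> split_ifs <;> first | omega | norm_num
  | insert i s hi ih =>
    have h := hp i (Finset.mem_insert_self i s)
    have := (ih fun j hj => hp j (Finset.mem_insert_of_mem hj)).bernoulli_step h.1 h.2
    rwa [← funext fun n => pmf_insert hi p n] at this

/-- The largest value of the Poisson binomial distribution. -/
def pmfMax (s : Finset ι) (p : ι → ℝ) : ℝ :=
  (Finset.range (s.card + 1)).sup' Finset.nonempty_range_add_one fun n : ℕ => pmf s p n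

theorem pmf_le_pmfMax {s : Finset ι} {p : ι → ℝ} (hp : p ∈ Set.Icc (0 : ι → ℝ) 1) (n : ℤ) :
    pmf s p n ≤ pmfMax s p := by
  have key : ∀ m : ℕ, m < s.card + 1 → pmf s p m ≤ pmfMax s p := fun m hm =>
    Finset.le_sup' (fun n : ℕ => pmf s p n) (Finset.mem_range.2 hm)
  by_cases h : n < 0 ∨ (s.card : ℤ) < n
  · rw [pmf_eq_zero h]
    exact (pmf_nonneg hp _).trans (key 0 (by omega))
  · have := key n.toNat (by omega)
    rwa [Int.toNat_of_nonneg (by omega)] at this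

theorem pmfMax_le {s : Finset ι} {p : ι → ℝ} {c : ℝ} (h : ∀ n, pmf s p n ≤ c) :
    pmfMax s p ≤ c :=
  Finset.sup'_le _ _ fun n _ => h n

theorem continuous_pmfMax (s : Finset ι) : Continuous (pmfMax s) := by
  unfold pmfMax
  exact Continuous.finset_sup'_apply _ fun n _ => continuous_pmf s n

/-- Two probabilities enter only through their sum and product, whose coefficients are, up to sign,
the first and second differences of the remaining distribution. -/
theorem pmf_insert_insert {s : Finset ι} {i j : ι} (hij : i ≠ j) (hi : i ∉ s) (hj : j ∉ s)
    (p : ι → ℝ) (n : ℤ) :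
    pmf (insert i (insert j s)) p n =
      pmf s p n - (p i + p j) * (pmf s p n - pmf s p (n - 1)) +
        p i * p j * (pmf s p n - pmf s p (n - 1) - (pmf s p (n - 1) - pmf s p (n - 2))) := by
  rw [pmf_insert (by simp [hij, hi]), pmf_insert hj, pmf_insert hj]
  have : n - 1 - 1 = n - 2 := by ring
  rw [this]
  ring

/-! ### Optimality of equal success probabilities -/

/-- Distinct success probabilities inside `(0, 1)` are not optimal. -/
theorem exists_pmfMax_lt {s : Finset ι} {p : ι → ℝ} (hp : p ∈ Set.Icc (0 : ι → ℝ) 1)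
    (hs : ∀ i ∈ s, 0 < p i ∧ p i < 1) {i j : ι} (hi : i ∈ s) (hj : j ∈ s) (hlt : p i < p j) :
    ∃ p' ∈ Set.Icc (0 : ι → ℝ) 1, pmfMax s p' < pmfMax s p := by
  have hij : i ≠ j := by rintro rfl; exact lt_irrefl _ hlt
  set r := (s.erase i).erase j with hr
  have hir : i ∉ r := by simp [hr]
  have hjr : j ∉ r := by simp [hr]
  have hsr : s = insert i (insert j r) := by
    rw [hr, Finset.insert_erase (Finset.mem_erase.2 ⟨hij.symm, hj⟩), Finset.insert_erase hi]
  have hB : StrictLogConcave (pmf r p) := strictLogConcave_pmf fun l hl =>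
    hs l (Finset.mem_of_mem_erase (Finset.mem_of_mem_erase hl))
  have hP : StrictLogConcave (pmf s p) := strictLogConcave_pmf hs
  set M := pmfMax s p with hM
  have hle : ∀ n, pmf s p n ≤ M := pmf_le_pmfMax hp
  have hMpos : 0 < M := lt_of_lt_of_le
    (by rw [pmf_zero]; exact Finset.prod_pos fun l hl => by linarith [(hs l hl).2]) (hle 0)
  have hex : ∃ n : ℕ, pmf s p n = M := by
    obtain ⟨n, -, hn⟩ := Finset.exists_mem_eq_sup' (Finset.nonempty_range_add_one (n := s.card))
      fun n : ℕ => pmf s p n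
    exact ⟨n, hn.symm⟩
  classical
  -- Taking the least mode leaves `m + 1` as the only other possible mode.
  set m := Nat.find hex with hm
  have hmM : pmf s p m = M := Nat.find_spec hex
  have hform : ∀ n, pmf s p n = _ := fun n => by rw [hsr, pmf_insert_insert hij hir hjr]
  have hvanish : ∀ n, pmf s p n = M →
      ¬ (pmf r p n = 0 ∧ pmf r p (n - 1) = 0 ∧ pmf r p (n - 2) = 0) := by
    rintro n hn ⟨z0, z1, z2⟩
    rw [hform, z0, z1, z2] at hn
    simp at hn
    linarith
  obtain ⟨α, β, hdir⟩ := hB.exists_direction m (hvanish m hmM)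
  -- With rates `σ = α + β` and `τ = β`, the change `-σ D n + τ (D n - D (n - 1))` becomes `-(α D n
  -- + β D (n - 1))`.
  obtain ⟨X, Y, hX, hY, hX0, hY0, hXY⟩ := exists_perturbation hlt (α + β) β
  set P : ℝ → ι → ℝ := fun ε => Function.update (Function.update p i (X ε)) j (Y ε) with hPdef
  have hPc : Continuous P := (continuous_const.update i hX).update j hY
  have hP0 : P 0 = p := by
    simp only [hPdef, hX0, hY0, Function.update_eq_self]
  have hPi : ∀ ε, P ε i = X ε := fun ε => by simp [hPdef, hij]
  have hPj : ∀ ε, P ε j = Y ε := fun ε => by simp [hPdef]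
  have hPl : ∀ ε l, l ≠ i → l ≠ j → P ε l = p l := fun ε l h1 h2 => by simp [hPdef, h1, h2]
  have hPr : ∀ ε n, pmf r (P ε) n = pmf r p n := fun ε n => pmf_congr (fun l hl =>
    hPl ε l (fun h => hir (h ▸ hl)) (fun h => hjr (h ▸ hl))) n
  have hchange : ∀ᶠ ε in 𝓝 (0 : ℝ), ∀ n, pmf s (P ε) n = pmf s p n -
      ε * (α * (pmf r p n - pmf r p (n - 1)) + β * (pmf r p (n - 1) - pmf r p (n - 2))) := by
    filter_upwards [hXY] with ε hε n
    rw [hform n, hsr, pmf_insert_insert hij hir hjr, hPi, hPj, hPr, hPr, hPr, hε.1, hε.2]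
    ring
  have hmem : ∀ᶠ ε in 𝓝 (0 : ℝ), P ε ∈ Set.Icc (0 : ι → ℝ) 1 := by
    have bd : ∀ (Z : ℝ → ℝ) (_ : Continuous Z), 0 < Z 0 ∧ Z 0 < 1 →
        ∀ᶠ ε in 𝓝 (0 : ℝ), 0 < Z ε ∧ Z ε < 1 := fun Z hZ h =>
      (hZ.continuousAt.eventually_const_lt h.1).and (hZ.continuousAt.eventually_lt_const h.2)
    filter_upwards [bd X hX (hX0 ▸ hs i hi), bd Y hY (hY0 ▸ hs j hj)] with ε h1 h2
    have : ∀ l, 0 ≤ P ε l ∧ P ε l ≤ 1 := by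
      intro l
      by_cases hlj : l = j
      · rw [hlj, hPj]; exact ⟨h2.1.le, h2.2.le⟩
      by_cases hli : l = i
      · rw [hli, hPi]; exact ⟨h1.1.le, h1.2.le⟩
      rw [hPl ε l hli hlj]
      exact ⟨hp.1 l, hp.2 l⟩
    exact ⟨fun l => (this l).1, fun l => (this l).2⟩
  -- Values below `M` stay below by continuity; the modes decrease linearly in `ε > 0`.
  have hdecr : ∀ᶠ ε in 𝓝[>] (0 : ℝ), ∀ n ∈ Finset.range (s.card + 1), pmf s (P ε) n < M := by
    rw [Filter.eventually_all_finset]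
    intro n _
    rcases (hle n).lt_or_eq with h | h
    · have hc : Continuous fun ε => pmf s (P ε) n := (continuous_pmf s n).comp hPc
      exact (hc.continuousAt.eventually_lt_const (by simpa only [hP0] using h)).filter_mono nhdsWithin_le_nhds
    · have h1 : m ≤ n := Nat.find_min' hex h
      have h2 := hP.lt_add_two_of_isMax hMpos hle hmM h
      have h3 := (hdir n (by omega)).resolve_right (hvanish n h)
      filter_upwards [hchange.filter_mono nhdsWithin_le_nhds, self_mem_nhdsWithin] with ε hε hpos
      rw [hε n, h]
      have := mul_pos (Set.mem_Ioi.1 hpos) h3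
      linarith
  obtain ⟨ε, h1, h2⟩ := (hdecr.and (hmem.filter_mono nhdsWithin_le_nhds)).exists
  exact ⟨P ε, h2, (Finset.sup'_lt_iff _).2 h1⟩

/-- Each new value is a convex combination of two adjacent old ones. -/
theorem pmfMax_insert_le {s : Finset ι} {i : ι} (hi : i ∉ s) {p : ι → ℝ}
    (hp : p ∈ Set.Icc (0 : ι → ℝ) 1) : pmfMax (insert i s) p ≤ pmfMax s p := by
  refine pmfMax_le fun n => ?_
  rw [pmf_insert hi]
  nlinarith [pmf_le_pmfMax (s := s) hp n, pmf_le_pmfMax (s := s) hp (n - 1),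
    show 0 ≤ p i from hp.1 i, show p i ≤ 1 from hp.2 i]

/-- Equal success probabilities are optimal. -/
theorem exists_const_pmfMax_le (s : Finset ι) {p : ι → ℝ} (hp : p ∈ Set.Icc (0 : ι → ℝ) 1) :
    ∃ q ∈ Set.Icc (0 : ℝ) 1, pmfMax s (fun _ => q) ≤ pmfMax s p := by
  induction hc : s.card generalizing s p with
  | zero =>
    obtain rfl := Finset.card_eq_zero.1 hc
    refine ⟨0, by simp, pmfMax_le fun n => ?_⟩
    rw [pmf_congr (p' := p) (by simp)]
    exact pmf_le_pmfMax hp n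
  | succ k ih =>
    obtain ⟨p₀, hp₀, hmin⟩ := (isCompact_Icc (a := (0 : ι → ℝ)) (b := 1)).exists_isMinOn
      ⟨p, hp⟩ (continuous_pmfMax s).continuousOn
    have hle : pmfMax s p₀ ≤ pmfMax s p := hmin hp
    by_cases hs : ∀ i ∈ s, 0 < p₀ i ∧ p₀ i < 1
    · obtain ⟨i, hi⟩ : s.Nonempty := Finset.card_pos.1 (by omega)
      have heq : ∀ j ∈ s, p₀ j = p₀ i := by
        intro j hj
        by_contra hne
        obtain ⟨p', hp', hlt⟩ : ∃ p' ∈ Set.Icc (0 : ι → ℝ) 1, pmfMax s p' < pmfMax s p₀ := by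
          rcases lt_or_gt_of_ne hne with h | h
          · exact exists_pmfMax_lt hp₀ hs hj hi h
          · exact exists_pmfMax_lt hp₀ hs hi hj h
        exact absurd (hmin hp') (not_le.2 hlt)
      refine ⟨p₀ i, ⟨hp₀.1 i, hp₀.2 i⟩, (pmfMax_le fun n => ?_).trans hle⟩
      rw [← pmf_congr heq]
      exact pmf_le_pmfMax hp₀ n
    -- A coordinate 0 or 1 can be dropped without changing the maximum, and the common `q` from
    -- induction can be assigned to it without increasing the maximum.
    · push Not at hs
      obtain ⟨i, hi, hbd⟩ := hs
      have hins : insert i (s.erase i) = s := Finset.insert_erase hi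
      have hni : i ∉ s.erase i := Finset.notMem_erase i s
      obtain ⟨q, hq, hqle⟩ := ih (s.erase i) hp₀ (by rw [Finset.card_erase_of_mem hi]; omega)
      refine ⟨q, hq, le_trans ?_ hle⟩
      refine (hins ▸ pmfMax_insert_le hni (const_mem_Icc hq)).trans (hqle.trans ?_)
      refine pmfMax_le fun n => ?_
      by_cases h0 : 0 < p₀ i
      · have h1 : p₀ i = 1 := le_antisymm (hp₀.2 i) (hbd h0)
        have := pmf_le_pmfMax (s := s) hp₀ (n + 1)
        rw [← hins, pmf_insert hni, h1, hins] at this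
        simpa using this
      · have h1 : p₀ i = 0 := le_antisymm (not_lt.1 h0) (hp₀.1 i)
        have := pmf_le_pmfMax (s := s) hp₀ n
        rw [← hins, pmf_insert hni, h1, hins] at this
        simpa using this

/-! ### Log-convexity of n^n/n! -/

/-- `n ^ n / n !` as a real number. -/
noncomputable def selfPowDivFactorial (n : ℕ) : ℝ := (n : ℝ) ^ n / (n.factorial : ℝ)

theorem selfPowDivFactorial_pos (n : ℕ) : 0 < selfPowDivFactorial n := by
  unfold selfPowDivFactorial
  rcases Nat.eq_zero_or_pos n with rfl | h
  · simp
  · positivity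

theorem selfPowDivFactorial_succ (n : ℕ) :
    selfPowDivFactorial (n + 1) = ((n : ℝ) + 1) ^ n / (n.factorial : ℝ) := by
  unfold selfPowDivFactorial
  rw [Nat.factorial_succ]
  push_cast
  have : (n.factorial : ℝ) ≠ 0 := by positivity
  field_simp
  ring

theorem selfPowDivFactorial_mul_succ_le (n : ℕ) :
    selfPowDivFactorial (n + 1) * selfPowDivFactorial (n + 1) ≤
      selfPowDivFactorial n * selfPowDivFactorial (n + 2) := by
  rw [selfPowDivFactorial_succ (n + 1)]
  nth_rewrite 2 [selfPowDivFactorial_succ]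
  unfold selfPowDivFactorial
  have hf : (0 : ℝ) < (n.factorial : ℝ) := by positivity
  have hf' : (0 : ℝ) < ((n + 1).factorial : ℝ) := by positivity
  rw [div_mul_div_comm, div_mul_div_comm, mul_comm (n.factorial : ℝ),
    div_le_div_iff_of_pos_right (by positivity)]
  push_cast
  have hn : (0 : ℝ) ≤ n := n.cast_nonneg
  set x : ℝ := (n : ℝ) + 1 with hx
  have hx1 : 1 ≤ x := by linarith
  have hx0 : 0 < x := by linarith
  -- After cancelling factorials and multiplying by `n`, the claim is n x^(2n+1) ≤ (x^2 - 1)^(n+1)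
  -- with x = n + 1. Bernoulli's inequality gives (1 - 1/x^2)^(n+1) ≥ 1 - 1/x = n/x.
  have hb := one_add_mul_le_pow (a := -(1 / x ^ 2)) (by
    have : 1 / x ^ 2 ≤ 1 := by rw [div_le_one (by positivity)]; nlinarith
    linarith) (n + 1)
  have hb1 : n * x ^ (2 * n + 1) ≤ ((n : ℝ) * (x + 1)) ^ (n + 1) := by
    have e1 : (n : ℝ) * (x + 1) = x ^ 2 * (1 + -(1 / x ^ 2)) := by
      field_simp; rw [hx]; ring
    rw [e1, mul_pow]
    have e2 : (n : ℝ) * x ^ (2 * n + 1) =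
        (x ^ 2) ^ (n + 1) * (1 + ((n + 1 : ℕ) : ℝ) * -(1 / x ^ 2)) := by
      push_cast
      rw [← hx, ← pow_mul]
      have : x ^ (2 * (n + 1)) = x ^ (2 * n + 1) * x := by ring
      rw [this]
      field_simp
      rw [hx]; ring
    rw [e2]
    exact mul_le_mul_of_nonneg_left hb (by positivity)
  rcases Nat.eq_zero_or_pos n with rfl | hpos
  · simp at hx ⊢
  · have hn0 : (0 : ℝ) < n := by exact_mod_cast hpos
    refine le_of_mul_le_mul_left ?_ hn0
    calc (n : ℝ) * (x ^ (n + 1) * x ^ n) = n * x ^ (2 * n + 1) := by ring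
      _ ≤ _ := hb1
      _ = _ := by rw [mul_pow]; ring

/-- Log-convexity makes the ratios of consecutive terms nondecreasing. -/
theorem selfPowDivFactorial_exchange {a b : ℕ} (hab : a ≤ b) :
    selfPowDivFactorial (a + 1) * selfPowDivFactorial b ≤
      selfPowDivFactorial a * selfPowDivFactorial (b + 1) := by
  induction b, hab using Nat.le_induction with
  | base => rw [mul_comm]
  | succ b hab ih =>
    have h1 := selfPowDivFactorial_mul_succ_le b
    have p0 := selfPowDivFactorial_pos a
    have p1 := selfPowDivFactorial_pos (a + 1)
    have p2 := selfPowDivFactorial_pos b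
    have p3 := selfPowDivFactorial_pos (b + 1)
    have p4 := selfPowDivFactorial_pos (b + 2)
    refine le_of_mul_le_mul_left ?_ (mul_pos p2 p3)
    have := mul_le_mul ih h1 (by positivity) (by positivity)
    nlinarith [this]

/-- Among pairs with a given sum the product is least at the balanced pair. -/
theorem selfPowDivFactorial_balanced (a b : ℕ) :
    selfPowDivFactorial ((a + b) / 2) * selfPowDivFactorial (a + b - (a + b) / 2) ≤
      selfPowDivFactorial a * selfPowDivFactorial b := by
  have key : ∀ d a b : ℕ, a ≤ b → b - a ≤ d →
      selfPowDivFactorial ((a + b) / 2) * selfPowDivFactorial (a + b - (a + b) / 2) ≤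
      selfPowDivFactorial a * selfPowDivFactorial b := by
    intro d
    induction d using Nat.strong_induction_on with
    | _ d ih =>
      intro a b hab hd
      by_cases h : b ≤ a + 1
      · rw [show (a + b) / 2 = a by omega, show a + b - a = b by omega]
      · obtain ⟨c, rfl⟩ : ∃ c, b = c + 1 := ⟨b - 1, by omega⟩
        have h1 := ih (d - 2) (by omega) (a + 1) c (by omega) (by omega)
        rw [show a + 1 + c = a + (c + 1) by omega] at h1
        exact h1.trans (selfPowDivFactorial_exchange (by omega))
  rcases le_total a b with h | h
  · exact key _ a b h le_rfl
  · have := key _ b a h le_rfl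
    rwa [add_comm b a, mul_comm (selfPowDivFactorial b)] at this

/-! ### The minimax for binomial distributions -/

/-- The value at `m` of the binomial distribution with parameters `k` and `m / (k + 1)`. -/
noncomputable def binomialPeak (k m : ℕ) : ℝ :=
  k.choose m * ((m : ℝ) / (k + 1)) ^ m * (1 - (m : ℝ) / (k + 1)) ^ (k - m)

theorem binomialPeak_eq {k m : ℕ} (hm : m ≤ k) : binomialPeak k m =
    k.factorial / ((k : ℝ) + 1) ^ k *
      (selfPowDivFactorial m * selfPowDivFactorial (k + 1 - m)) := by
  obtain ⟨b, rfl⟩ := Nat.exists_eq_add_of_le hm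
  rw [show m + b + 1 - m = b + 1 by omega, selfPowDivFactorial_succ]
  unfold binomialPeak selfPowDivFactorial
  rw [Nat.cast_choose ℝ hm, show m + b - m = b by omega]
  push_cast
  have h0 : (m : ℝ) + b + 1 ≠ 0 := by positivity
  have e : 1 - (m : ℝ) / (m + b + 1) = (b + 1) / (m + b + 1) := by field_simp; ring
  rw [e, div_pow, div_pow, pow_add ((m : ℝ) + b + 1) m b]
  field_simp

/-- Together with `binomialPeak_eq` this evaluates the probability of `j` at both ends of its
interval; in each case the two arguments sum to `k + 1`. -/
theorem binomial_succ_endpoint_eq {k j : ℕ} (hj : j ≤ k) :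
    (k.choose j : ℝ) * (((j : ℝ) + 1) / (k + 1)) ^ j * (1 - ((j : ℝ) + 1) / (k + 1)) ^ (k - j) =
    k.factorial / ((k : ℝ) + 1) ^ k *
      (selfPowDivFactorial (j + 1) * selfPowDivFactorial (k - j)) := by
  obtain ⟨b, rfl⟩ := Nat.exists_eq_add_of_le hj
  rw [selfPowDivFactorial_succ]
  unfold selfPowDivFactorial
  rw [Nat.cast_choose ℝ hj, show j + b - j = b by omega]
  push_cast
  have h0 : (j : ℝ) + b + 1 ≠ 0 := by positivity
  have e : 1 - ((j : ℝ) + 1) / (j + b + 1) = b / (j + b + 1) := by field_simp; ring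
  rw [e, div_pow, div_pow, pow_add ((j : ℝ) + b + 1) j b]
  field_simp

/-- `x ^ m * (1 - x) ^ n` is quasiconcave on `[0, 1]`. -/
theorem le_pow_mul_one_sub_pow {a b q c : ℝ} {m n : ℕ} (ha : 0 ≤ a) (hb : b ≤ 1)
    (haq : a ≤ q) (hqb : q ≤ b) (hc : 0 ≤ c) (h1 : c ≤ a ^ m * (1 - a) ^ n)
    (h2 : c ≤ b ^ m * (1 - b) ^ n) : c ≤ q ^ m * (1 - q) ^ n := by
  rcases eq_or_lt_of_le (haq.trans hqb) with hab | hab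
  · rwa [le_antisymm haq (hab ▸ hqb)] at h1
  obtain ⟨u, v, hu, hv, huv, hq⟩ : ∃ u v : ℝ, 0 ≤ u ∧ 0 ≤ v ∧ u + v = 1 ∧ u * a + v * b = q := by
    have : 0 < b - a := by linarith
    refine ⟨(b - q) / (b - a), (q - a) / (b - a), div_nonneg (by linarith) this.le,
      div_nonneg (by linarith) this.le, ?_, ?_⟩ <;> field_simp <;> ring
  have hb0 : 0 ≤ b := by linarith
  have ha1 : 0 ≤ 1 - a := by linarith
  have hb1 : 0 ≤ 1 - b := by linarith
  -- Weighted AM-GM for `q` and for `1 - q` replaces concavity of the logarithm and also covers the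
  -- endpoints 0 and 1.
  have g1 := Real.geom_mean_le_arith_mean2_weighted hu hv ha hb0 huv
  have g2 := Real.geom_mean_le_arith_mean2_weighted hu hv ha1 hb1 huv
  rw [hq] at g1
  have e2 : u * (1 - a) + v * (1 - b) = 1 - q := by rw [← hq]; linear_combination huv
  rw [e2] at g2
  have swap : ∀ (x : ℝ) (_ : 0 ≤ x) (w : ℝ) (l : ℕ), (x ^ w) ^ l = (x ^ l) ^ w := fun x hx w l => by
    rw [← Real.rpow_natCast, ← Real.rpow_natCast, ← Real.rpow_mul hx, ← Real.rpow_mul hx, mul_comm]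
  calc c = c ^ u * c ^ v := by
        rcases eq_or_lt_of_le hc with rfl | hpos
        · rcases eq_or_ne u 0 with rfl | h
          · have : v ≠ 0 := by linarith
            simp [Real.zero_rpow this]
          · simp [Real.zero_rpow h]
        · rw [← Real.rpow_add hpos, huv, Real.rpow_one]
    _ ≤ (a ^ m * (1 - a) ^ n) ^ u * (b ^ m * (1 - b) ^ n) ^ v :=
        mul_le_mul (Real.rpow_le_rpow hc h1 hu) (Real.rpow_le_rpow hc h2 hv)
          (Real.rpow_nonneg hc _) (Real.rpow_nonneg (by positivity) _)
    _ = (a ^ u * b ^ v) ^ m * ((1 - a) ^ u * (1 - b) ^ v) ^ n := by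
        rw [Real.mul_rpow (by positivity) (by positivity),
          Real.mul_rpow (by positivity) (by positivity), mul_pow, mul_pow, swap a ha,
          swap b hb0, swap _ ha1, swap _ hb1]
        ring
    _ ≤ q ^ m * (1 - q) ^ n := by
        have : 0 ≤ a ^ u * b ^ v := by positivity
        have : 0 ≤ (1 - a) ^ u * (1 - b) ^ v := by positivity
        have : 0 ≤ q := ha.trans haq
        gcongr

/-- Every binomial distribution with `k` trials has a value at least `binomialPeak` at the
middle. -/
theorem exists_binomialPeak_le (k : ℕ) {q : ℝ} (hq : q ∈ Set.Icc (0 : ℝ) 1) :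
    ∃ j ≤ k, binomialPeak k ((k + 1) / 2) ≤ k.choose j * q ^ j * (1 - q) ^ (k - j) := by
  have hk : (0 : ℝ) < (k : ℝ) + 1 := by positivity
  -- The choice is `j = ⌊q (k + 1)⌋`, except at `q = 1`, where the floor would be `k + 1`.
  obtain ⟨j, hj, h1, h2⟩ : ∃ j : ℕ, j ≤ k ∧ (j : ℝ) / (k + 1) ≤ q ∧ q ≤ ((j : ℝ) + 1) / (k + 1) := by
    rcases eq_or_lt_of_le hq.2 with rfl | hlt
    · exact ⟨k, le_rfl, by rw [div_le_one hk]; linarith, by rw [div_self hk.ne']⟩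
    · have h0 : 0 ≤ q * (k + 1) := mul_nonneg hq.1 hk.le
      refine ⟨⌊q * (k + 1)⌋₊, ?_, ?_, ?_⟩
      · have : ⌊q * (k + 1)⌋₊ < k + 1 := by
          rw [Nat.floor_lt h0]; push_cast; nlinarith
        omega
      · rw [div_le_iff₀ hk]; exact Nat.floor_le h0
      · rw [le_div_iff₀ hk]; exact (Nat.lt_floor_add_one _).le
  have hch : (0 : ℝ) < k.choose j := by exact_mod_cast Nat.choose_pos hj
  have hpk : ∀ a b : ℕ, a + b = k + 1 → binomialPeak k ((k + 1) / 2) ≤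
      k.factorial / ((k : ℝ) + 1) ^ k * (selfPowDivFactorial a * selfPowDivFactorial b) := by
    intro a b hab
    rcases Nat.eq_zero_or_pos k with rfl | hk0
    · have : binomialPeak 0 ((0 + 1) / 2) = 1 := by simp [binomialPeak]
      rw [this]
      have : (a = 0 ∧ b = 1) ∨ (a = 1 ∧ b = 0) := by omega
      rcases this with ⟨rfl, rfl⟩ | ⟨rfl, rfl⟩ <;> simp [selfPowDivFactorial]
    rw [binomialPeak_eq (by omega), ← hab]
    exact mul_le_mul_of_nonneg_left (selfPowDivFactorial_balanced a b) (by positivity)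
  refine ⟨j, hj, ?_⟩
  have c0 : 0 ≤ binomialPeak k ((k + 1) / 2) := by
    unfold binomialPeak
    have : (((k + 1) / 2 : ℕ) : ℝ) / (k + 1) ≤ 1 := by
      rw [div_le_one hk]; exact_mod_cast (Nat.div_le_self _ _)
    have : 0 ≤ 1 - (((k + 1) / 2 : ℕ) : ℝ) / (k + 1) := by linarith
    positivity
  rw [mul_assoc, mul_comm, ← div_le_iff₀ hch]
  refine le_pow_mul_one_sub_pow (by positivity) ?_ h1 h2 (by positivity) ?_ ?_
  · rw [div_le_one hk]
    have : (j : ℝ) ≤ k := by exact_mod_cast hj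
    linarith
  · rw [div_le_iff₀ hch, mul_comm, ← mul_assoc]
    have := hpk j (k + 1 - j) (by omega)
    rwa [← binomialPeak_eq hj] at this
  · rw [div_le_iff₀ hch, mul_comm, ← mul_assoc, binomial_succ_endpoint_eq hj]
    exact hpk (j + 1) (k - j) (by omega)

/-- `m` is a mode of the binomial distribution with parameters `k` and `m / (k + 1)`. -/
theorem binomial_le_binomialPeak {k m n : ℕ} (hm : m ≤ k) (hn : n ≤ k) :
    k.choose n * ((m : ℝ) / (k + 1)) ^ n * (1 - (m : ℝ) / (k + 1)) ^ (k - n) ≤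
      binomialPeak k m := by
  unfold binomialPeak
  have hk : (0 : ℝ) < (k : ℝ) + 1 := by positivity
  have hmk : (m : ℝ) ≤ k := by exact_mod_cast hm
  set q : ℝ := (m : ℝ) / (k + 1) with hq
  have hq0 : 0 ≤ q := by positivity
  have hq1 : 0 ≤ 1 - q := by
    rw [sub_nonneg, hq, div_le_one hk]; linarith
  have hqm : q * (k + 1) = m := by rw [hq]; field_simp
  -- Consecutive probabilities have ratio (k-l)q : (l+1)(1-q); the common factor `t` avoids dividing
  -- by zero. Since `q (k + 1) = m`, the comparison reduces to `l + 1` against `m`.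
  have step : ∀ l, l < k → ∃ t : ℝ, 0 ≤ t ∧
      (k.choose l * q ^ l * (1 - q) ^ (k - l)) = t * ((l + 1) * (1 - q)) ∧
      (k.choose (l + 1) * q ^ (l + 1) * (1 - q) ^ (k - (l + 1))) = t * ((k - l) * q) := by
    intro l hl
    refine ⟨k.choose l * q ^ l * (1 - q) ^ (k - (l + 1)) / (l + 1), by positivity, ?_, ?_⟩
    · rw [show k - l = k - (l + 1) + 1 by omega, pow_succ]
      field_simp
    · have h := Nat.choose_succ_right_eq k l
      have h' : (k.choose (l + 1) : ℝ) * (l + 1) = k.choose l * (k - l) := by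
        rw [← Nat.cast_sub hl.le]; exact_mod_cast h
      have : (k.choose (l + 1) : ℝ) = k.choose l * (k - l) / (l + 1) := by
        rw [eq_div_iff (by positivity), h']
      rw [this, pow_succ]
      field_simp
  rcases le_total n m with h | h
  · induction h using Nat.decreasingInduction with
    | of_succ l hl ih =>
      refine le_trans ?_ (ih (by omega))
      obtain ⟨t, ht, e1, e2⟩ := step l (by omega)
      rw [e1, e2]
      refine mul_le_mul_of_nonneg_left ?_ ht
      have : (l : ℝ) + 1 ≤ m := by exact_mod_cast hl
      nlinarith
    | self => exact le_rfl
  · induction n, h using Nat.le_induction with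
    | base => exact le_rfl
    | succ l hl ih =>
      refine le_trans ?_ (ih (by omega))
      obtain ⟨t, ht, e1, e2⟩ := step l (by omega)
      rw [e1, e2]
      refine mul_le_mul_of_nonneg_left ?_ ht
      have : (m : ℝ) ≤ l := by exact_mod_cast hl
      nlinarith

/-! ### Convolutions on {0,1} as Poisson binomial distributions -/

theorem pbProb_eq_pmf {k : ℕ} (p : Fin k → ℝ) (j : ℕ) :
    pbProb p j = pmf Finset.univ p j := by
  unfold pbProb pmf
  rw [← Finset.sum_filter, Finset.powersetCard_eq_filter]
  refine Finset.sum_congr (by simp) fun S _ => ?_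
  rw [Finset.compl_eq_univ_sdiff]

theorem pbMax_eq_pmfMax {k : ℕ} (p : Fin k → ℝ) : pbMax p = pmfMax Finset.univ p := by
  unfold pbMax pmfMax
  simp only [Finset.card_univ, Fintype.card_fin, pbProb_eq_pmf]

theorem pbProb_const {k : ℕ} (q : ℝ) (j : ℕ) :
    pbProb (fun _ : Fin k => q) j = k.choose j * q ^ j * (1 - q) ^ (k - j) := by
  unfold pbProb
  rw [Finset.sum_congr rfl (g := fun _ => q ^ j * (1 - q) ^ (k - j))]
  · simp [mul_assoc]
  · intro S hS
    simp [Finset.card_compl, (Finset.mem_powersetCard.1 hS).2]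

/-- A point of the cube corresponds to the set of its coordinates equal to 1. -/
theorem conv_natCast {k : ℕ} (f : Fin k → Fin (1 + 1) → ℝ) (j : ℕ) :
    conv f j = ∑ S ∈ Finset.powersetCard j Finset.univ,
      (∏ i ∈ S, f i 1) * ∏ i ∈ Sᶜ, f i 0 := by
  have hval : ∀ t : Fin (1 + 1), (t : ℕ) = if t = 1 then 1 else 0 := by decide
  have hne : ∀ t : Fin (1 + 1), t ≠ 1 → t = 0 := by decide
  unfold conv
  refine Finset.sum_bij' (fun x _ => Finset.univ.filter fun i => x i = 1)
    (fun S _ i => if i ∈ S then 1 else 0) ?_ ?_ ?_ ?_ ?_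
  · intro x hx
    rw [Finset.mem_powersetCard_univ, Finset.card_filter]
    have := (Finset.mem_filter.1 hx).2
    simp only [hval] at this
    exact_mod_cast this
  · intro S hS
    rw [Finset.mem_powersetCard_univ] at hS
    simp [hval, ← hS]
  · intro x _
    funext i
    by_cases h : x i = 1
    · simp [h]
    · simp [hne _ h]
  · intro S _
    ext i
    simp
  · intro x _
    rw [← Finset.prod_mul_prod_compl (Finset.univ.filter fun i => x i = 1)]
    congr 1
    · exact Finset.prod_congr rfl fun i hi => by rw [(Finset.mem_filter.1 hi).2]
    · refine Finset.prod_congr rfl fun i hi => ?_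
      rw [hne (x i) fun h => Finset.mem_compl.1 hi (by simpa using h)]

theorem conv_eq_zero_of_neg {k m : ℕ} (f : Fin k → Fin (m + 1) → ℝ) {n : ℤ} (hn : n < 0) :
    conv f n = 0 := by
  unfold conv
  refine Finset.sum_eq_zero fun x hx => ?_
  have h := (Finset.mem_filter.1 hx).2
  have : 0 ≤ ∑ i, ((x i : ℕ) : ℤ) := Finset.sum_nonneg fun i _ => by positivity
  omega

theorem bddAbove_range_abs_conv {k m : ℕ} (f : Fin k → Fin (m + 1) → ℝ) :
    BddAbove (Set.range fun n : ℤ => |conv f n|) := by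
  refine ⟨∑ x : Fin k → Fin (m + 1), |∏ i, f i (x i)|, ?_⟩
  rintro _ ⟨n, rfl⟩
  exact (Finset.abs_sum_le_sum_abs _ _).trans
    (Finset.sum_le_sum_of_subset_of_nonneg (Finset.filter_subset _ _) fun _ _ _ => abs_nonneg _)

theorem abs_conv_le_supNorm {k m : ℕ} (f : Fin k → Fin (m + 1) → ℝ) (n : ℤ) :
    |conv f n| ≤ supNorm (conv f) :=
  le_ciSup (bddAbove_range_abs_conv f) n

theorem supNorm_nonneg (g : ℤ → ℝ) : 0 ≤ supNorm g :=
  Real.iSup_nonneg fun _ => abs_nonneg _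

/-- The Bernoulli distribution on `{0, 1}`. -/
def bernoulli (p : ℝ) : Fin (1 + 1) → ℝ := ![1 - p, p]

theorem bernoulli_nonneg {p : ℝ} (hp : p ∈ Set.Icc (0 : ℝ) 1) (j : Fin (1 + 1)) :
    0 ≤ bernoulli p j := by
  have h1 := hp.1
  have h2 := hp.2
  fin_cases j <;> simp [bernoulli] <;> linarith

theorem l1Norm_bernoulli {p : ℝ} (hp : p ∈ Set.Icc (0 : ℝ) 1) : l1Norm (bernoulli p) = 1 := by
  unfold l1Norm
  simp only [abs_of_nonneg (bernoulli_nonneg hp _)]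
  simp [bernoulli]

theorem conv_bernoulli {k : ℕ} (p : Fin k → ℝ) (j : ℕ) :
    conv (fun i => bernoulli (p i)) j = pbProb p j := by
  rw [conv_natCast]
  simp [pbProb, bernoulli]

theorem conv_smul {k m : ℕ} (L : Fin k → ℝ) (f : Fin k → Fin (m + 1) → ℝ) (n : ℤ) :
    conv (fun i j => L i * f i j) n = (∏ i, L i) * conv f n := by
  unfold conv
  rw [Finset.mul_sum]
  exact Finset.sum_congr rfl fun x _ => Finset.prod_mul_distrib

theorem pbProb_le_pbMax {k : ℕ} {p : Fin k → ℝ} (hp : p ∈ Set.Icc (0 : Fin k → ℝ) 1) (j : ℕ) :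
    pbProb p j ≤ pbMax p := by
  rw [pbProb_eq_pmf, pbMax_eq_pmfMax]
  exact pmf_le_pmfMax hp j

theorem pbProb_nonneg {k : ℕ} {p : Fin k → ℝ} (hp : p ∈ Set.Icc (0 : Fin k → ℝ) 1) (j : ℕ) :
    0 ≤ pbProb p j := by
  rw [pbProb_eq_pmf]
  exact pmf_nonneg hp j

theorem supNorm_conv_bernoulli_le {k : ℕ} {p : Fin k → ℝ}
    (hp : p ∈ Set.Icc (0 : Fin k → ℝ) 1) :
    supNorm (conv fun i => bernoulli (p i)) ≤ pbMax p := by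
  refine ciSup_le fun n => ?_
  rcases lt_or_ge n 0 with h | h
  · rw [conv_eq_zero_of_neg _ h, abs_zero]
    exact (pbProb_nonneg hp 0).trans (pbProb_le_pbMax hp 0)
  · lift n to ℕ using h
    rw [conv_bernoulli, abs_of_nonneg (pbProb_nonneg hp n)]
    exact pbProb_le_pbMax hp n

theorem exists_pbProb_eq_pbMax {k : ℕ} (p : Fin k → ℝ) : ∃ j : ℕ, pbProb p j = pbMax p := by
  obtain ⟨j, -, hj⟩ := Finset.exists_mem_eq_sup' (Finset.nonempty_range_add_one (n := k)) (pbProb p)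
  exact ⟨j, hj.symm⟩

/-! ### The best constants -/

/-- The optimal common success probability. -/
noncomputable def optimalProb (k : ℕ) : ℝ := (((k + 1) / 2 : ℕ) : ℝ) / (k + 1)

theorem optimalProb_mem (k : ℕ) : optimalProb k ∈ Set.Icc (0 : ℝ) 1 := by
  unfold optimalProb
  refine ⟨by positivity, ?_⟩
  rw [div_le_one (by positivity)]
  exact_mod_cast Nat.div_le_self (k + 1) 2

theorem pbMax_optimalProb {k : ℕ} (hk : 1 ≤ k) :
    pbMax (fun _ : Fin k => optimalProb k) = binomialPeak k ((k + 1) / 2) := by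
  apply le_antisymm
  · refine Finset.sup'_le _ _ fun n hn => ?_
    rw [pbProb_const]
    exact binomial_le_binomialPeak (by omega) (by simpa [Nat.lt_succ_iff] using hn)
  · have := pbProb_le_pbMax (k := k) (const_mem_Icc (optimalProb_mem k)) ((k + 1) / 2)
    rwa [pbProb_const] at this

theorem binomialPeak_le_pbMax {k : ℕ} {p : Fin k → ℝ} (hp : p ∈ Set.Icc (0 : Fin k → ℝ) 1) :
    binomialPeak k ((k + 1) / 2) ≤ pbMax p := by
  obtain ⟨q, hq, hle⟩ := exists_const_pmfMax_le Finset.univ hp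
  obtain ⟨j, -, hj⟩ := exists_binomialPeak_le k hq
  rw [← pbProb_const] at hj
  rw [← pbMax_eq_pmfMax, ← pbMax_eq_pmfMax] at hle
  exact hj.trans ((pbProb_le_pbMax (const_mem_Icc hq) j).trans hle)

theorem binomialPeak_mem_constants (k : ℕ) :
    binomialPeak k ((k + 1) / 2) ∈ constants k 1 := by
  intro f hf
  -- A vanishing factor cannot be normalised, but then the left-hand side is zero.
  by_cases hL : ∃ i, l1Norm (f i) = 0
  · obtain ⟨i, hi⟩ := hL
    rw [Finset.prod_eq_zero (Finset.mem_univ i) hi, mul_zero]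
    exact supNorm_nonneg _
  · push Not at hL
    have hsum : ∀ i, l1Norm (f i) = f i 0 + f i 1 := fun i => by
      unfold l1Norm
      simp only [abs_of_nonneg (hf i _)]
      exact Fin.sum_univ_two _
    have hLpos : ∀ i, 0 < l1Norm (f i) := fun i =>
      lt_of_le_of_ne (Finset.sum_nonneg fun _ _ => abs_nonneg _) (hL i).symm
    set p : Fin k → ℝ := fun i => f i 1 / l1Norm (f i) with hpdef
    have hp : p ∈ Set.Icc (0 : Fin k → ℝ) 1 := by
      refine ⟨fun i => div_nonneg (hf i 1) (hLpos i).le, fun i => ?_⟩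
      have h0 := hf i 0
      exact (div_le_one (hLpos i)).2 (by rw [hsum]; linarith)
    have hfe : f = fun i j => l1Norm (f i) * bernoulli (p i) j := by
      funext i j
      have := hL i
      fin_cases j
      · simp only [bernoulli, hpdef]
        change f i 0 = l1Norm (f i) * (1 - f i 1 / l1Norm (f i))
        field_simp
        rw [hsum]; ring
      · simp only [bernoulli, hpdef]
        change f i 1 = l1Norm (f i) * (f i 1 / l1Norm (f i))
        field_simp
    have hprod : 0 ≤ ∏ i, l1Norm (f i) := Finset.prod_nonneg fun i _ => (hLpos i).le
    obtain ⟨j, hj⟩ := exists_pbProb_eq_pbMax p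
    have hconv : conv f j = (∏ i, l1Norm (f i)) * pbMax p := by
      rw [hfe, conv_smul, conv_bernoulli, hj, ← hfe]
    calc binomialPeak k ((k + 1) / 2) * ∏ i, l1Norm (f i)
        ≤ pbMax p * ∏ i, l1Norm (f i) :=
          mul_le_mul_of_nonneg_right (binomialPeak_le_pbMax hp) hprod
      _ = conv f j := by rw [hconv, mul_comm]
      _ ≤ |conv f j| := le_abs_self _
      _ ≤ _ := abs_conv_le_supNorm f j

theorem constants_subset_diagConstants (k m : ℕ) : constants k m ⊆ diagConstants k m := by
  intro C hC f hf
  have := hC (fun _ => f) fun _ => hf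
  simpa using this

/-- The Bernoulli distribution with the optimal probability is the test function showing that no
larger constant works. -/
theorem isGreatest_diagConstants {k : ℕ} (hk : 1 ≤ k) :
    IsGreatest (diagConstants k 1) (binomialPeak k ((k + 1) / 2)) := by
  refine ⟨constants_subset_diagConstants k 1 (binomialPeak_mem_constants k), fun C hC => ?_⟩
  have h := hC (bernoulli (optimalProb k)) (bernoulli_nonneg (optimalProb_mem k))
  rw [l1Norm_bernoulli (optimalProb_mem k), one_pow, mul_one] at h
  exact h.trans ((supNorm_conv_bernoulli_le (const_mem_Icc (optimalProb_mem k))).trans_eq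
    (pbMax_optimalProb hk))

theorem isGreatest_constants {k : ℕ} (hk : 1 ≤ k) :
    IsGreatest (constants k 1) (binomialPeak k ((k + 1) / 2)) :=
  ⟨binomialPeak_mem_constants k, fun _ hC =>
    (isGreatest_diagConstants hk).2 (constants_subset_diagConstants k 1 hC)⟩

/-- On two points, each value of the diagonal convolution is a multiple of a single monomial in `f
0` and `f 1`, so signs cause no cancellation. -/
theorem abs_conv_const {k : ℕ} (f : Fin (1 + 1) → ℝ) (n : ℤ) :
    |conv (fun _ : Fin k => f) n| = |conv (fun _ : Fin k => fun j => |f j|) n| := by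
  rcases lt_or_ge n 0 with h | h
  · rw [conv_eq_zero_of_neg _ h, conv_eq_zero_of_neg _ h]
  · lift n to ℕ using h
    have key : ∀ g : Fin (1 + 1) → ℝ, conv (fun _ : Fin k => g) n =
        k.choose n * (g 1 ^ n * g 0 ^ (k - n)) := by
      intro g
      rw [conv_natCast, Finset.sum_congr rfl (g := fun _ => g 1 ^ n * g 0 ^ (k - n))]
      · simp
      · intro S hS
        simp [Finset.card_compl, (Finset.mem_powersetCard.1 hS).2]
    rw [key, key]
    simp [abs_mul, abs_pow]

theorem diagConstants_le_of_real {k : ℕ} {C : ℝ} (hC : C ∈ diagConstants k 1)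
    (f : Fin (1 + 1) → ℝ) :
    C * l1Norm f ^ k ≤ supNorm (conv fun _ : Fin k => f) := by
  have h := hC (fun j => |f j|) fun _ => abs_nonneg _
  have e : l1Norm (fun j => |f j|) = l1Norm f := by simp [l1Norm]
  rw [e] at h
  refine h.trans_eq ?_
  unfold supNorm
  exact congrArg _ (funext fun n => (abs_conv_const f n).symm)

/-! ### Closed forms -/

theorem binomialPeak_of_odd {k : ℕ} (hk : Odd k) :
    binomialPeak k ((k + 1) / 2) = (k.choose (k / 2) : ℝ) / 2 ^ k := by
  obtain ⟨r, rfl⟩ := hk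
  have e1 : (2 * r + 1 + 1) / 2 = r + 1 := by omega
  have e2 : (2 * r + 1) / 2 = r := by omega
  have e3 : 2 * r + 1 - (r + 1) = r := by omega
  have e4 : (((r + 1 : ℕ) : ℝ)) / (((2 * r + 1 : ℕ) : ℝ) + 1) = 1 / 2 := by
    push_cast
    rw [div_eq_div_iff (by positivity) (by norm_num)]
    ring
  have e5 : (2 * r + 1).choose (r + 1) = (2 * r + 1).choose r :=
    Nat.choose_symm_of_eq_add (by omega)
  unfold binomialPeak
  rw [e1, e2, e3, e4, e5, show (1 : ℝ) - 1 / 2 = 1 / 2 by norm_num, mul_assoc, ← pow_add,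
    show r + 1 + r = 2 * r + 1 by omega, one_div, inv_pow, div_eq_mul_inv]

theorem binomialPeak_of_even {k : ℕ} (hk : Even k) :
    binomialPeak k ((k + 1) / 2) =
      (k.choose (k / 2) : ℝ) / 2 ^ k * (1 - 1 / ((k : ℝ) + 1) ^ 2) ^ ((k : ℝ) / 2) := by
  obtain ⟨r, rfl⟩ := hk
  have e1 : (r + r + 1) / 2 = r := by omega
  have e2 : (r + r) / 2 = r := by omega
  have e3 : r + r - r = r := by omega
  have e4 : ((r + r : ℕ) : ℝ) / 2 = (r : ℕ) := by push_cast; ring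
  unfold binomialPeak
  have e5 : (r : ℝ) / ((r + r : ℕ) + 1) * (1 - (r : ℝ) / ((r + r : ℕ) + 1)) =
      (1 - 1 / (((r + r : ℕ) : ℝ) + 1) ^ 2) / (2 * 2) := by
    push_cast
    have : (r : ℝ) + r + 1 ≠ 0 := by positivity
    field_simp
    ring
  rw [e1, e2, e3, e4, Real.rpow_natCast, mul_assoc, ← mul_pow, e5, div_pow, pow_add, mul_pow]
  ring

theorem binomialPeak_eq_closed_form (k : ℕ) :
    binomialPeak k ((k + 1) / 2) = (k.choose (k / 2) : ℝ) *
        (((⌊((k : ℝ) + 1) / 2⌋₊ : ℝ) * (⌈((k : ℝ) + 1) / 2⌉₊ : ℝ)) / ((k : ℝ) + 1) ^ 2) ^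
          ((k : ℝ) / 2) := by
  have hfloor : ⌊((k : ℝ) + 1) / 2⌋₊ = (k + 1) / 2 := by
    have := Nat.floor_div_eq_div (K := ℝ) (k + 1) 2
    push_cast at this
    exact this
  rw [hfloor]
  rcases Nat.even_or_odd k with hk | hk
  · have hceil : ⌈((k : ℝ) + 1) / 2⌉₊ = k / 2 + 1 := by
      obtain ⟨r, rfl⟩ := hk
      rw [Nat.ceil_eq_iff (by omega), show (r + r) / 2 = r by omega]
      push_cast
      constructor <;> linarith
    rw [binomialPeak_of_even hk, hceil]
    obtain ⟨r, rfl⟩ := hk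
    rw [show (r + r + 1) / 2 = r by omega, show (r + r) / 2 = r by omega,
      show ((r + r : ℕ) : ℝ) / 2 = (r : ℕ) by push_cast; ring, Real.rpow_natCast,
      Real.rpow_natCast, div_mul_eq_mul_div, mul_div_assoc, pow_add, ← mul_pow, ← div_pow]
    congr 2
    push_cast
    have : (r : ℝ) + r + 1 ≠ 0 := by positivity
    field_simp
    ring
  · have hceil : ⌈((k : ℝ) + 1) / 2⌉₊ = (k + 1) / 2 := by
      obtain ⟨r, rfl⟩ := hk
      rw [Nat.ceil_eq_iff (by omega), show (2 * r + 1 + 1) / 2 = r + 1 by omega]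
      push_cast
      constructor <;> linarith
    rw [binomialPeak_of_odd hk, hceil]
    -- For odd `k` floor and ceiling coincide, so the base is 1/4; writing it as a square absorbs
    -- the half in the exponent.
    have e : ((((k + 1) / 2 : ℕ) : ℝ) * (((k + 1) / 2 : ℕ) : ℝ)) / ((k : ℝ) + 1) ^ 2 =
        (1 / 2 : ℝ) ^ (2 : ℝ) := by
      obtain ⟨r, rfl⟩ := hk
      rw [show (2 * r + 1 + 1) / 2 = r + 1 by omega, Real.rpow_two]
      push_cast
      field_simp
      ring
    rw [e, ← Real.rpow_mul (by norm_num), mul_div_cancel₀ _ (by norm_num), Real.rpow_natCast,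
      one_div, inv_pow, div_eq_mul_inv]

end ConvCube

theorem theorem1 (k : ℕ) (hk : 2 ≤ k) :
    -- the two best constants are attained as constants of the inequalities
    IsGreatest (ConvCube.constants k 1) (ConvCube.bestConst k 1) ∧
    IsGreatest (ConvCube.diagConstants k 1) (ConvCube.diagBestConst k 1) ∧
    -- they agree
    ConvCube.bestConst k 1 = ConvCube.diagBestConst k 1 ∧
    -- the closed formula
    ConvCube.bestConst k 1 =
      (k.choose (k / 2) : ℝ) *
        (((⌊((k : ℝ) + 1) / 2⌋₊ : ℝ) * (⌈((k : ℝ) + 1) / 2⌉₊ : ℝ)) / ((k : ℝ) + 1) ^ 2) ^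
          ((k : ℝ) / 2) ∧
    (Odd k → ConvCube.bestConst k 1 = (k.choose (k / 2) : ℝ) / 2 ^ k) ∧
    (Even k → ConvCube.bestConst k 1 =
      (k.choose (k / 2) : ℝ) / 2 ^ k * (1 - 1 / ((k : ℝ) + 1) ^ 2) ^ ((k : ℝ) / 2)) ∧
    -- the diagonal inequality holds for real-valued functions too
    (∀ f : Fin 2 → ℝ, ConvCube.diagBestConst k 1 * ConvCube.l1Norm f ^ k ≤
      ConvCube.supNorm (ConvCube.conv fun _ : Fin k => f)) ∧
    -- the least value of the largest Poisson binomial probability, attained on the diagonal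
    IsLeast (ConvCube.pbMax '' Set.Icc (0 : Fin k → ℝ) 1) (ConvCube.bestConst k 1) ∧
    ∃ q ∈ Set.Icc (0 : ℝ) 1,
      ConvCube.pbMax (fun _ : Fin k => q) = ConvCube.bestConst k 1 := by
  have hk1 : 1 ≤ k := by omega
  have hc := ConvCube.isGreatest_constants hk1
  have hd := ConvCube.isGreatest_diagConstants hk1
  have eb : ConvCube.bestConst k 1 = ConvCube.binomialPeak k ((k + 1) / 2) := hc.csSup_eq
  have ed : ConvCube.diagBestConst k 1 = ConvCube.binomialPeak k ((k + 1) / 2) := hd.csSup_eq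
  have hopt := ConvCube.optimalProb_mem k
  have hmax := ConvCube.pbMax_optimalProb hk1
  rw [eb, ed]
  refine ⟨hc, hd, rfl, ConvCube.binomialPeak_eq_closed_form k, ConvCube.binomialPeak_of_odd,
    ConvCube.binomialPeak_of_even, ConvCube.diagConstants_le_of_real hd.1,
    ⟨⟨_, ConvCube.const_mem_Icc hopt, hmax⟩, ?_⟩, ConvCube.optimalProb k, hopt, hmax⟩
  rintro _ ⟨p, hp, rfl⟩
  exact ConvCube.binomialPeak_le_pbMax hp
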